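/- Theorem A. Let $1<p<\infty$. Let $\ell_p$ be the space of $p$-summable scalar sequences and $c_0$ the space of scalar sequences tending to $0$ with the supremum norm, where the scalars are either the real or the complex numbers. Let $\mathcal L(\ell_p,c_0)$ be the space of all bounded linear maps $\ell_p\to c_0$. A closed ideal of $\mathcal L(\ell_p,c_0)$ is a linear subspace $\mathcal J\subset\mathcal L(\ell_p,c_0)$ which is closed in the operator norm and satisfies $ATB\in\mathcal J$ for all bounded linear maps $A\colon c_0\to c_0$, all $T\in\mathcal J$ and all bounded linear maps $B\colon\ell_p\to\ell_p$. Then $\mathcal L(\ell_p,c_0)$ has continuum many closed ideals, i.e. the set of closed ideals of $\mathcal L(\ell_p,c_0)$ has cardinality at least $2^{\aleph_0}$. -/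

import Mathlib

open scoped ENNReal ZeroAtInfty

section OperatorIdeals

variable {𝕜 X Y : Type*} [NontriviallyNormedField 𝕜]
  [NormedAddCommGroup X] [NormedSpace 𝕜 X] [NormedAddCommGroup Y] [NormedSpace 𝕜 Y]

/-- An (operator) ideal of `L(X, Y)`: a linear subspace `J` of the space of bounded linear maps
such that `A T B ∈ J` whenever `A ∈ L(Y)`, `T ∈ J` and `B ∈ L(X)`. -/
def IsOperatorIdeal (J : Submodule 𝕜 (X →L[𝕜] Y)) : Prop :=
  ∀ (A : Y →L[𝕜] Y) (T : X →L[𝕜] Y) (B : X →L[𝕜] X), T ∈ J → (A.comp T).comp B ∈ J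

variable (𝕜 X Y) in
/-- The set of all closed ideals of `L(X, Y)`: the operator ideals which are closed in the
operator norm topology. -/
def closedOperatorIdeals : Set (Submodule 𝕜 (X →L[𝕜] Y)) :=
  {J | IsOperatorIdeal J ∧ IsClosed (J : Set (X →L[𝕜] Y))}

end OperatorIdeals

/-! Level `m` of a `BlockDesign` carries `q m ^ (s + 3)` blocks of size `q m` in a set `K m` of `q m
^ 2` points; distinct blocks meet in at most `s + 3` points. Let φ_i be the normalised sum over
block i and v_j the normalised indicator of block j, so φ_j(v_j) = 1. For a set N of levels, T_N :
ℓ_p → c₀ has the coordinates φ_i with level in N. The closed ideal J_M consists of the S such that,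
for every B, the average of ‖S B v_j‖ over level m tends to 0 as m → ∞ in M.

Taking B = id shows T_M ∉ J_M for infinite M. The crux is that T_N ∈ J_M when M ∩ N is finite.
Continuum many infinite, pairwise almost disjoint sets of levels then give distinct ideals.

For the crux, fix m ∉ N and count the j of level m with |φ_i(B v_j)| ≥ ε for some i of level in N
(`card_bad_le`). By duality and the small overlaps, one φ_i serves boundedly many j
(`card_vectors_le`). Levels below m have few indices because q grows fast. Above m, φ_i must be at
least ε / q m on some B e_z with z ∈ `K m`, and each z allows only O(q m ^ s) such i
(`card_functionals_le`). Altogether O(q m ^ (s + 2)) indices j are bad, a vanishing fraction of `q m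
^ (s + 3)`. -/

/-! ### Counting almost disjoint blocks with large normalised sums. -/

section FiniteSums

open Finset

variable {𝕜 : Type*} [RCLike 𝕜]

/-- Hölder's inequality for a sum over a subset `O`, weighted by a power of a larger number. -/
theorem weighted_norm_sum_le {P Q : ℝ} (h : P.HolderConjugate Q) (x : ℕ → 𝕜) (O : Finset ℕ)
    {n : ℝ} (hn : 0 < n) :
    n ^ (-Q⁻¹) * ‖∑ z ∈ O, x z‖ ≤ (#O / n) ^ Q⁻¹ * (∑ z ∈ O, ‖x z‖ ^ P) ^ P⁻¹ := by
  have h1 : ‖∑ z ∈ O, x z‖ ≤ (#O : ℝ) ^ Q⁻¹ * (∑ z ∈ O, ‖x z‖ ^ P) ^ P⁻¹ := by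
    have := Real.inner_le_Lp_mul_Lq_of_nonneg O h.symm (f := fun _ => 1) (g := fun z => ‖x z‖)
      (fun _ _ => zero_le_one) (fun _ _ => norm_nonneg _)
    simp only [one_mul, Real.one_rpow, sum_const, nsmul_eq_mul, mul_one, one_div] at this
    exact (norm_sum_le _ _).trans this
  rw [Real.div_rpow (by positivity) hn.le, Real.rpow_neg hn.le]
  calc (n ^ Q⁻¹)⁻¹ * ‖∑ z ∈ O, x z‖
      ≤ (n ^ Q⁻¹)⁻¹ * ((#O : ℝ) ^ Q⁻¹ * (∑ z ∈ O, ‖x z‖ ^ P) ^ P⁻¹) := by gcongr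
    _ = _ := by ring

/-- Delete from each block its overlaps `O i` with the others. They fill at most a fraction c^(-s)
of the block, so by Hölder they contribute at most b / c ≤ δ / 2. The remaining pieces are disjoint
and each has ℓ_P-mass at least (δ / 2)^P, so there are at most (2b / δ)^P ≤ c^s of them. -/
theorem card_le_pow_of_card_eq {P Q : ℝ} (h : P.HolderConjugate Q) {s D c : ℕ} (hsP : P ≤ s)
    (hsQ : Q ≤ s) (hc : 1 ≤ c) (x : ℕ → 𝕜) {b δ : ℝ} (hb : 0 ≤ b) (hδ : 0 < δ)
    (hx : ∀ U : Finset ℕ, ∑ z ∈ U, ‖x z‖ ^ P ≤ b ^ P) (hbδ : 2 * b ≤ c * δ)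
    (S : ℕ → Finset ℕ) (R : Finset ℕ)
    (hS : ∀ i ∈ R, D * #R * c ^ s ≤ #(S i)) (hS0 : ∀ i ∈ R, 0 < #(S i))
    (hover : ∀ i ∈ R, ∀ j ∈ R, i ≠ j → #(S i ∩ S j) ≤ D)
    (hR : ∀ i ∈ R, δ ≤ (#(S i) : ℝ) ^ (-Q⁻¹) * ‖∑ z ∈ S i, x z‖) : #R ≤ c ^ s := by
  classical
  have hP := h.pos
  have hQ := h.symm.pos
  have hc' : (1 : ℝ) ≤ c := by exact_mod_cast hc
  have hc0 : (0 : ℝ) < c := by positivity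
  set O : ℕ → Finset ℕ := fun i => (R.erase i).biUnion fun j => S i ∩ S j with hO
  have hOS : ∀ i, O i ⊆ S i := fun i => biUnion_subset.2 fun j _ => inter_subset_left
  have hOcard : ∀ i ∈ R, #(O i) ≤ #R * D := fun i hi =>
    (card_biUnion_le_card_mul _ _ D fun j hj =>
      hover i hi j (mem_of_mem_erase hj) (ne_of_mem_erase hj).symm).trans
      (Nat.mul_le_mul_right _ (card_le_card (erase_subset _ _)))
  have hdisj : (R : Set ℕ).PairwiseDisjoint fun i => S i \ O i := by
    intro i hi j hj hij
    refine disjoint_left.2 fun z hz hz' => ?_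
    simp only [mem_sdiff] at hz hz'
    exact hz.2 (mem_biUnion.2 ⟨j, mem_erase.2 ⟨hij.symm, hj⟩, mem_inter.2 ⟨hz.1, hz'.1⟩⟩)
  have key : ∀ i ∈ R, (δ / 2) ^ P ≤ ∑ z ∈ S i \ O i, ‖x z‖ ^ P := by
    intro i hi
    have hn : (0 : ℝ) < #(S i) := by exact_mod_cast hS0 i hi
    have hsplit : ∑ z ∈ S i, x z = ∑ z ∈ S i \ O i, x z + ∑ z ∈ O i, x z :=
      (sum_sdiff (hOS i)).symm
    have h1 := weighted_norm_sum_le h x (O i) hn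
    have h2 := weighted_norm_sum_le h x (S i \ O i) hn
    have hratio : (#(O i) : ℝ) / #(S i) ≤ ((c : ℝ) ^ s)⁻¹ := by
      rw [div_le_iff₀ hn, ← div_eq_inv_mul, le_div_iff₀ (by positivity)]
      have : #(O i) * c ^ s ≤ #(S i) := by
        refine le_trans ?_ (hS i hi)
        rw [mul_comm D]
        exact Nat.mul_le_mul_right _ (hOcard i hi)
      exact_mod_cast this
    have h3 : ((#(O i) : ℝ) / #(S i)) ^ Q⁻¹ ≤ (c : ℝ)⁻¹ := by
      calc ((#(O i) : ℝ) / #(S i)) ^ Q⁻¹ ≤ (((c : ℝ) ^ s)⁻¹) ^ Q⁻¹ := by gcongr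
        _ = ((c : ℝ)⁻¹) ^ ((s : ℝ) * Q⁻¹) := by
          rw [← inv_pow, ← Real.rpow_natCast, ← Real.rpow_mul (by positivity)]
        _ ≤ ((c : ℝ)⁻¹) ^ (1 : ℝ) := by
          apply Real.rpow_le_rpow_of_exponent_ge (by positivity) (inv_le_one_of_one_le₀ hc')
          rw [← div_eq_mul_inv, le_div_iff₀ hQ]; simpa using hsQ
        _ = _ := Real.rpow_one _
    have h4 : (∑ z ∈ O i, ‖x z‖ ^ P) ^ P⁻¹ ≤ b := by
      rw [Real.rpow_inv_le_iff_of_pos (by positivity) hb hP]; exact hx _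
    have h5 : (#(S i) : ℝ) ^ (-Q⁻¹) * ‖∑ z ∈ O i, x z‖ ≤ δ / 2 := by
      refine h1.trans ((mul_le_mul h3 h4 (by positivity) (by positivity)).trans ?_)
      rw [inv_mul_le_iff₀ hc0]; linarith
    have h6 : (#(S i \ O i) / #(S i) : ℝ) ^ Q⁻¹ ≤ 1 := by
      apply Real.rpow_le_one (by positivity) _ (by positivity)
      rw [div_le_one hn]
      exact_mod_cast card_le_card sdiff_subset
    have h7 : (#(S i) : ℝ) ^ (-Q⁻¹) * ‖∑ z ∈ S i \ O i, x z‖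
        ≤ (∑ z ∈ S i \ O i, ‖x z‖ ^ P) ^ P⁻¹ :=
      h2.trans (mul_le_of_le_one_left (by positivity) h6)
    have h8 : δ / 2 ≤ (∑ z ∈ S i \ O i, ‖x z‖ ^ P) ^ P⁻¹ := by
      have h9 := hR i hi
      rw [hsplit] at h9
      have h10 : (#(S i) : ℝ) ^ (-Q⁻¹) * ‖∑ z ∈ S i \ O i, x z + ∑ z ∈ O i, x z‖ ≤
        (#(S i) : ℝ) ^ (-Q⁻¹) * ‖∑ z ∈ S i \ O i, x z‖ +
          (#(S i) : ℝ) ^ (-Q⁻¹) * ‖∑ z ∈ O i, x z‖ := by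
        rw [← mul_add]; gcongr; exact norm_add_le _ _
      linarith
    rwa [Real.le_rpow_inv_iff_of_pos (by positivity) (by positivity) hP] at h8
  have htot : #R * (δ / 2) ^ P ≤ b ^ P := by
    calc #R * (δ / 2) ^ P = ∑ i ∈ R, (δ / 2) ^ P := by simp
      _ ≤ ∑ i ∈ R, ∑ z ∈ S i \ O i, ‖x z‖ ^ P := sum_le_sum key
      _ = ∑ z ∈ R.biUnion fun i => S i \ O i, ‖x z‖ ^ P := (sum_biUnion hdisj).symm
      _ ≤ _ := hx _
  have h11 : b ^ P ≤ (c : ℝ) ^ s * (δ / 2) ^ P := by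
    calc b ^ P ≤ (c * (δ / 2)) ^ P := by
          apply Real.rpow_le_rpow hb _ hP.le; linarith
      _ = (c : ℝ) ^ P * (δ / 2) ^ P := Real.mul_rpow hc0.le (by positivity)
      _ ≤ (c : ℝ) ^ (s : ℝ) * (δ / 2) ^ P := by gcongr
      _ = _ := by rw [Real.rpow_natCast]
  have h12 : (#R : ℝ) ≤ (c : ℝ) ^ s := le_of_mul_le_mul_right (htot.trans h11) (by positivity)
  exact_mod_cast h12

/-- If the normalised block sums of a vector in the `b`-ball of `ℓ_P` over almost disjoint large
blocks are bounded below by `δ`, then there are few blocks. -/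
theorem card_le_pow_of_le_block_sum {P Q : ℝ} (h : P.HolderConjugate Q) {s D c : ℕ} (hsP : P ≤ s)
    (hsQ : Q ≤ s) (hc : 1 ≤ c) (x : ℕ → 𝕜) {b δ : ℝ} (hb : 0 ≤ b) (hδ : 0 < δ)
    (hx : ∀ U : Finset ℕ, ∑ z ∈ U, ‖x z‖ ^ P ≤ b ^ P) (hbδ : 2 * b ≤ c * δ)
    (S : ℕ → Finset ℕ) (R : Finset ℕ)
    (hS : ∀ i ∈ R, D * (c ^ s + 1) * c ^ s ≤ #(S i)) (hS0 : ∀ i ∈ R, 0 < #(S i))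
    (hover : ∀ i ∈ R, ∀ j ∈ R, i ≠ j → #(S i ∩ S j) ≤ D)
    (hR : ∀ i ∈ R, δ ≤ (#(S i) : ℝ) ^ (-Q⁻¹) * ‖∑ z ∈ S i, x z‖) : #R ≤ c ^ s := by
  -- The size condition of the previous lemma involves `#R`, so it is applied to a subfamily of
  -- exactly c^s + 1 blocks.
  by_contra! hlt
  obtain ⟨R', hR'R, hR'⟩ := exists_subset_card_eq (Nat.succ_le_of_lt hlt)
  have := card_le_pow_of_card_eq h hsP hsQ hc x hb hδ hx hbδ S R'
    (fun i hi => by simpa [hR'] using hS i (hR'R hi)) (fun i hi => hS0 i (hR'R hi))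
    (fun i hi j hj => hover i (hR'R hi) j (hR'R hj)) (fun i hi => hR i (hR'R hi))
  omega

end FiniteSums

/-! ### Block functionals and block vectors in ℓ_p. -/

section SequenceSpace

open Finset

variable {𝕜 : Type*} [RCLike 𝕜] {p : ℝ≥0∞}

/-- The coefficients of a functional on `ℓ_p` lie in the ball of the dual sequence space. -/
theorem sum_norm_apply_single_rpow_le [Fact (1 ≤ p)] {Q : ℝ} (h : p.toReal.HolderConjugate Q)
    (g : lp (fun _ : ℕ => 𝕜) p →L[𝕜] 𝕜) (U : Finset ℕ) :
    ∑ z ∈ U, ‖g (lp.single p z (1 : 𝕜))‖ ^ Q ≤ ‖g‖ ^ Q := by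
  have hP := h.pos
  have hQ := h.symm.pos
  set γ : ℕ → 𝕜 := fun z => g (lp.single p z (1 : 𝕜)) with hγ
  -- The extremal vector for Hölder's inequality: a γ = |γ|^Q and |a|^p = |γ|^Q.
  set a : ℕ → 𝕜 := fun z => (starRingEnd 𝕜 (γ z)) * ((‖γ z‖ ^ (Q - 2) : ℝ) : 𝕜) with ha
  set A := ∑ z ∈ U, ‖γ z‖ ^ Q with hA
  have hA0 : 0 ≤ A := by positivity
  have hmul : ∀ z, a z * γ z = ((‖γ z‖ ^ Q : ℝ) : 𝕜) := by
    intro z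
    rcases eq_or_ne (γ z) 0 with h0 | h0
    · simp [ha, h0, Real.zero_rpow hQ.ne']
    · have : 0 < ‖γ z‖ := norm_pos_iff.2 h0
      rw [ha]
      simp only
      rw [mul_right_comm, RCLike.conj_mul, ← RCLike.ofReal_pow, ← RCLike.ofReal_mul,
        ← Real.rpow_natCast, ← Real.rpow_add this]
      norm_num
  have hnorm : ∀ z, ‖a z‖ ^ p.toReal = ‖γ z‖ ^ Q := by
    intro z
    rcases eq_or_ne (γ z) 0 with h0 | h0
    · simp [ha, h0, Real.zero_rpow hQ.ne', Real.zero_rpow hP.ne']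
    · have h1 : 0 < ‖γ z‖ := norm_pos_iff.2 h0
      have h2 : ‖a z‖ = ‖γ z‖ ^ (Q - 1) := by
        rw [ha]
        simp only [norm_mul, RCLike.norm_conj, RCLike.norm_ofReal]
        rw [abs_of_nonneg (by positivity)]
        nth_rewrite 1 [← Real.rpow_one ‖γ z‖]
        rw [← Real.rpow_add h1]; congr 1; ring
      rw [h2, ← Real.rpow_mul h1.le]
      congr 1
      exact h.symm.sub_one_mul_conj
  have hval : g (∑ z ∈ U, lp.single p z (a z)) = ((A : ℝ) : 𝕜) := by
    rw [map_sum, hA, RCLike.ofReal_sum]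
    refine sum_congr rfl fun z _ => ?_
    have hsingle : lp.single (E := fun _ : ℕ => 𝕜) p z (a z) = a z • lp.single p z (1 : 𝕜) := by
      rw [← lp.single_smul, smul_eq_mul, mul_one]
    rw [← hmul, hsingle, map_smul, smul_eq_mul]
  have hn : ‖∑ z ∈ U, lp.single p z (a z)‖ = A ^ (p.toReal)⁻¹ := by
    have := lp.norm_sum_single hP a U
    simp only [hnorm] at this
    rw [hA, ← this, Real.rpow_rpow_inv (norm_nonneg _) hP.ne']
  have hle : A ≤ ‖g‖ * A ^ (p.toReal)⁻¹ := by
    have := g.le_opNorm (∑ z ∈ U, lp.single p z (a z))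
    rwa [hval, hn, RCLike.norm_ofReal, abs_of_nonneg hA0] at this
  rcases hA0.eq_or_lt with h0 | h0
  · rw [← h0]; positivity
  · have h1 : A ^ Q⁻¹ ≤ ‖g‖ := by
      have h2 : A = A ^ Q⁻¹ * A ^ (p.toReal)⁻¹ := by
        rw [← Real.rpow_add h0, add_comm, h.inv_add_inv_eq_one, Real.rpow_one]
      refine le_of_mul_le_mul_right (a := A ^ (p.toReal)⁻¹) ?_ (by positivity)
      rwa [← h2]
    rwa [Real.rpow_inv_le_iff_of_pos hA0 (norm_nonneg _) hQ] at h1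

/-- The functional `x ↦ |S|^{-1/Q} ∑_{z ∈ S} x z` on `ℓ_p`. -/
noncomputable def blockFunctional (Q : ℝ) (S : Finset ℕ) :
    lp (fun _ : ℕ => 𝕜) p →ₗ[𝕜] 𝕜 where
  toFun x := (((#S : ℝ) ^ (-Q⁻¹) : ℝ) : 𝕜) * ∑ z ∈ S, x z
  map_add' x y := by
    simp only [lp.coeFn_add, Pi.add_apply, sum_add_distrib, mul_add]
  map_smul' c x := by simp [← mul_sum, mul_left_comm]

theorem norm_blockFunctional_apply (Q : ℝ) (S : Finset ℕ)
    (x : lp (fun _ : ℕ => 𝕜) p) :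
    ‖blockFunctional Q S x‖ = (#S : ℝ) ^ (-Q⁻¹) * ‖∑ z ∈ S, x z‖ := by
  simp only [blockFunctional, LinearMap.coe_mk, AddHom.coe_mk, norm_mul, RCLike.norm_ofReal]
  rw [abs_of_nonneg (by positivity)]

theorem norm_blockFunctional_rpow_le {Q : ℝ} (h : p.toReal.HolderConjugate Q) {S : Finset ℕ}
    (hS : 0 < #S) (x : lp (fun _ : ℕ => 𝕜) p) :
    ‖blockFunctional Q S x‖ ^ p.toReal ≤ ∑ z ∈ S, ‖x z‖ ^ p.toReal := by
  have hn : (0 : ℝ) < #S := by exact_mod_cast hS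
  rw [norm_blockFunctional_apply]
  have := weighted_norm_sum_le h x S hn
  rw [div_self hn.ne', Real.one_rpow, one_mul] at this
  rwa [Real.le_rpow_inv_iff_of_pos (by positivity) (by positivity) h.pos] at this

theorem norm_blockFunctional_le [Fact (1 ≤ p)] {Q : ℝ} (h : p.toReal.HolderConjugate Q) {S : Finset ℕ}
    (hS : 0 < #S) (x : lp (fun _ : ℕ => 𝕜) p) : ‖blockFunctional Q S x‖ ≤ ‖x‖ := by
  rw [← Real.rpow_le_rpow_iff (norm_nonneg _) (norm_nonneg _) h.pos]
  exact (norm_blockFunctional_rpow_le h hS x).trans (lp.sum_rpow_le_norm_rpow h.pos x S)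

variable (𝕜 p) in
/-- The normalised indicator `|S|^{-1/p} 1_S` in `ℓ_p`. -/
noncomputable def blockVector (S : Finset ℕ) : lp (fun _ : ℕ => 𝕜) p :=
  (((#S : ℝ) ^ (-(p.toReal)⁻¹) : ℝ) : 𝕜) • ∑ z ∈ S, lp.single p z (1 : 𝕜)

theorem norm_blockVector_le [Fact (1 ≤ p)] {S : Finset ℕ} (hp : 0 < p.toReal) (hS : 0 < #S) :
    ‖blockVector 𝕜 p S‖ ≤ 1 := by
  have hn : (0 : ℝ) < #S := by exact_mod_cast hS
  have h1 : ‖∑ z ∈ S, lp.single p z (1 : 𝕜)‖ = (#S : ℝ) ^ (p.toReal)⁻¹ := by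
    have := lp.norm_sum_single hp (fun _ : ℕ => (1 : 𝕜)) S
    simp only [norm_one, Real.one_rpow, sum_const, nsmul_eq_mul, mul_one] at this
    rw [← this, Real.rpow_rpow_inv (norm_nonneg _) hp.ne']
  rw [blockVector, norm_smul, h1, RCLike.norm_ofReal, abs_of_nonneg (by positivity),
    ← Real.rpow_add hn]
  simp

theorem norm_apply_blockVector [Fact (1 ≤ p)] (g : lp (fun _ : ℕ => 𝕜) p →L[𝕜] 𝕜) (S : Finset ℕ) :
    ‖g (blockVector 𝕜 p S)‖ =
      (#S : ℝ) ^ (-(p.toReal)⁻¹) * ‖∑ z ∈ S, g (lp.single p z (1 : 𝕜))‖ := by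
  rw [blockVector, map_smul, map_sum, norm_smul, RCLike.norm_ofReal,
    abs_of_nonneg (by positivity)]

theorem blockFunctional_blockVector {Q : ℝ} (h : p.toReal.HolderConjugate Q) {S : Finset ℕ}
    (hS : 0 < #S) : blockFunctional Q S (blockVector 𝕜 p S) = 1 := by
  have hn : (0 : ℝ) < #S := by exact_mod_cast hS
  have h1 : ∀ z ∈ S, (blockVector 𝕜 p S) z = (((#S : ℝ) ^ (-(p.toReal)⁻¹) : ℝ) : 𝕜) := by
    intro z hz
    simp only [blockVector, lp.coeFn_smul, Pi.smul_apply, lp.coeFn_sum, Finset.sum_apply,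
      lp.coeFn_single, Finset.sum_pi_single, hz, if_true, smul_eq_mul, mul_one]
  simp only [blockFunctional, LinearMap.coe_mk, AddHom.coe_mk]
  have h2 : (#S : ℝ) ^ (-Q⁻¹) * (#S * (#S : ℝ) ^ (-(p.toReal)⁻¹)) = 1 := by
    nth_rewrite 2 [← Real.rpow_one (#S : ℝ)]
    rw [← Real.rpow_add hn, ← Real.rpow_add hn]
    have := h.inv_add_inv_eq_one
    rw [show -Q⁻¹ + (1 + -(p.toReal)⁻¹) = 0 by linarith, Real.rpow_zero]
  have h3 := congrArg (RCLike.ofReal (K := 𝕜)) h2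
  rw [RCLike.ofReal_mul, RCLike.ofReal_mul, RCLike.ofReal_natCast, RCLike.ofReal_one] at h3
  rw [sum_congr rfl h1, sum_const, nsmul_eq_mul, h3]

end SequenceSpace

/-! ### Blocks as graphs of polynomials over finite fields. -/

section Design

open Finset

/-- A sequence of levels, each consisting of `q m ^ (s + 3)` blocks of size `q m` in a set of
`q m ^ 2` points, with bounded overlaps, whose sizes `q m` grow very fast. -/
structure BlockDesign (s : ℕ) where
  q : ℕ → ℕ
  lev : ℕ → ℕ
  I : ℕ → Finset ℕ
  K : ℕ → Finset ℕ
  S : ℕ → Finset ℕ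
  q_strictMono : StrictMono q
  q_pos : ∀ m, 0 < q m
  growth : ∀ m, (s + 3) * ((m * q m) ^ s + 1) * (m * q m) ^ s ≤ q (m + 1)
  mul_sum_le : ∀ m, m * ∑ l ∈ range m, q l ^ (s + 3) ≤ q m
  mem_I : ∀ i m, i ∈ I m ↔ lev i = m
  card_I : ∀ m, #(I m) = q m ^ (s + 3)
  card_K : ∀ m, #(K m) = q m ^ 2
  disjoint_K : Pairwise fun m n => Disjoint (K m) (K n)
  S_subset : ∀ i, S i ⊆ K (lev i)
  card_S : ∀ i, #(S i) = q (lev i)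
  card_inter : ∀ i j, i ≠ j → lev i = lev j → #(S i ∩ S j) ≤ s + 3

theorem exists_prime_seq (F : ℕ → ℕ → ℕ) :
    ∃ q : ℕ → ℕ, (∀ m, (q m).Prime) ∧ ∀ m, F m (q m) ≤ q (m + 1) := by
  refine ⟨fun m => Nat.rec 2 (fun m x => (Nat.exists_infinite_primes (F m x)).choose) m, ?_, ?_⟩
  · rintro (_ | m)
    · exact Nat.prime_two
    · exact (Nat.exists_infinite_primes (F m _)).choose_spec.2
  · intro m
    exact (Nat.exists_infinite_primes (F m _)).choose_spec.1

/-- The polynomial function with given coefficients. -/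
noncomputable def coeffEval {F : Type*} [Field F] {D : ℕ} (a : Fin D → F) (x : F) : F :=
  ((Polynomial.degreeLTEquiv F D).symm a : Polynomial F).eval x

theorem card_coeffEval_eq_le {F : Type*} [Field F] [Fintype F] [DecidableEq F] {D : ℕ}
    {a b : Fin D → F} (hab : a ≠ b) : #{x | coeffEval a x = coeffEval b x} ≤ D := by
  by_contra! hlt
  apply hab
  have hdeg : ∀ c : Fin D → F, ((Polynomial.degreeLTEquiv F D).symm c : Polynomial F).degree <
      #{x | coeffEval a x = coeffEval b x} := fun c =>
    (Polynomial.mem_degreeLT.1 ((Polynomial.degreeLTEquiv F D).symm c).2).trans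
      (by exact_mod_cast hlt)
  have := Polynomial.eq_of_degrees_lt_of_eval_finset_eq _ (hdeg a) (hdeg b)
    fun x hx => (mem_filter.1 hx).2
  exact (Polynomial.degreeLTEquiv F D).symm.injective (Subtype.ext this)

theorem nonempty_blockDesign (s : ℕ) : Nonempty (BlockDesign s) := by
  classical
  -- The three summands force, in order, `mul_sum_le`, `growth` and strict monotonicity.
  obtain ⟨q, hq, hF⟩ := exists_prime_seq fun m x =>
    (m + 1) * ((m + 1) * x ^ (s + 3)) + (s + 3) * ((m * x) ^ s + 1) * (m * x) ^ s + (x + 1)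
  have hmono : StrictMono q := strictMono_nat_of_lt_succ fun m => by
    have := hF m; omega
  have : ∀ m, Fact (q m).Prime := fun m => ⟨hq m⟩
  -- A block is the graph of a polynomial of degree below s + 3 in the plane over `ZMod (q m)`; two
  -- such graphs meet only where the polynomials agree. Indices are put in bijection with ℕ, since
  -- every natural number must have a level; points need only an injection.
  let Idx := Σ m, (Fin (s + 3) → ZMod (q m))
  let Pt := Σ m, ZMod (q m) × ZMod (q m)
  have : Infinite Idx := Infinite.of_injective (fun m => (⟨m, 0⟩ : Idx))
    fun m n h => congrArg Sigma.fst h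
  obtain ⟨_⟩ := nonempty_denumerable Idx
  let e : Idx ≃ ℕ := Denumerable.eqv Idx
  obtain ⟨f, hf⟩ := exists_injective_nat Pt
  have hpair : ∀ {m} {x y : ZMod (q m) × ZMod (q m)}, (⟨m, x⟩ : Pt) = ⟨m, y⟩ → x = y :=
    fun h => eq_of_heq (Sigma.mk.inj h).2
  let g : Idx → Finset ℕ := fun i => univ.image fun x => f ⟨i.1, x, coeffEval i.2 x⟩
  refine ⟨{
    q := q
    lev := fun i => (e.symm i).1
    I := fun m => univ.image fun a => e ⟨m, a⟩
    K := fun m => univ.image fun x => f ⟨m, x⟩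
    S := fun i => g (e.symm i)
    q_strictMono := hmono
    q_pos := fun m => (hq m).pos
    growth := fun m => ?_
    mul_sum_le := ?_
    mem_I := fun i m => ?_
    card_I := fun m => ?_
    card_K := fun m => ?_
    disjoint_K := fun m n hmn => ?_
    S_subset := fun i => ?_
    card_S := fun i => ?_
    card_inter := fun i j => ?_ }⟩
  · have := hF m; omega
  · rintro (_ | m)
    · simp
    · have h1 : ∑ l ∈ range (m + 1), q l ^ (s + 3) ≤ (m + 1) * q m ^ (s + 3) := by
        refine (sum_le_card_nsmul _ _ (q m ^ (s + 3)) fun l hl => ?_).trans (by simp)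
        exact Nat.pow_le_pow_left (hmono.monotone (Nat.lt_succ_iff.1 (mem_range.1 hl))) _
      have h2 := hF m
      have h3 := Nat.mul_le_mul_left (m + 1) h1
      omega
  · simp only [mem_image, mem_univ, true_and]
    constructor
    · rintro ⟨a, rfl⟩; simp
    · rintro rfl; exact ⟨(e.symm i).2, by simp⟩
  · rw [card_image_of_injective _ fun a b h => sigma_mk_injective (e.injective h)]
    simp [ZMod.card]
  · rw [card_image_of_injective _ fun a b h => sigma_mk_injective (hf h)]
    simp [ZMod.card, sq]
  · simp only [disjoint_left, mem_image, mem_univ, true_and]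
    rintro _ ⟨x, rfl⟩ ⟨y, hy⟩
    exact hmn (congrArg Sigma.fst (hf hy)).symm
  · intro z
    simp only [g, mem_image, mem_univ, true_and]
    rintro ⟨x, rfl⟩
    exact ⟨_, rfl⟩
  · simp only [g]
    rw [card_image_of_injective _ fun a b h =>
      congrArg Prod.fst (hpair (hf h))]
    simp [ZMod.card]
  · obtain ⟨⟨m, a⟩, rfl⟩ := e.surjective i
    obtain ⟨⟨n, b⟩, rfl⟩ := e.surjective j
    simp only [Equiv.symm_apply_apply]
    rintro hne rfl
    have hab : a ≠ b := fun h => hne (by rw [h])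
    refine le_trans (card_le_card ?_) ((card_image_le (f := fun x => f ⟨m, x, coeffEval a x⟩)).trans
      (card_coeffEval_eq_le hab))
    intro z
    simp only [g, mem_inter, mem_image, mem_univ, true_and, mem_filter]
    rintro ⟨⟨x, rfl⟩, ⟨y, hy⟩⟩
    obtain ⟨rfl, h2⟩ := Prod.mk.inj (hpair (hf hy))
    exact ⟨y, h2.symm, rfl⟩

end Design

/-! ### Closed ideals defined by vanishing averages. -/

section AverageNullIdeal

open Finset Filter Topology

variable {𝕜 X Y : Type*} [NontriviallyNormedField 𝕜]
  [NormedAddCommGroup X] [NormedSpace 𝕜 X] [NormedAddCommGroup Y] [NormedSpace 𝕜 Y]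

/-- The average of `‖S x‖` over the vectors `v j`, `j ∈ I`. -/
noncomputable def averageNorm (v : ℕ → X) (I : Finset ℕ) (S : X →L[𝕜] Y) : ℝ :=
  (∑ j ∈ I, ‖S (v j)‖) / #I

theorem averageNorm_nonneg (v : ℕ → X) (I : Finset ℕ) (S : X →L[𝕜] Y) : 0 ≤ averageNorm v I S := by
  unfold averageNorm; positivity

theorem averageNorm_add_le (v : ℕ → X) (I : Finset ℕ) (S T : X →L[𝕜] Y) :
    averageNorm v I (S + T) ≤ averageNorm v I S + averageNorm v I T := by
  rw [averageNorm, averageNorm, averageNorm, ← add_div, ← sum_add_distrib]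
  gcongr
  exact norm_add_le _ _

theorem averageNorm_comp_le {Z : Type*} [NormedAddCommGroup Z] [NormedSpace 𝕜 Z]
    (v : ℕ → X) (I : Finset ℕ) (A : Y →L[𝕜] Z) (S : X →L[𝕜] Y) :
    averageNorm v I (A.comp S) ≤ ‖A‖ * averageNorm v I S := by
  rw [averageNorm, averageNorm, ← mul_div_assoc, mul_sum]
  gcongr
  exact A.le_opNorm _

theorem averageNorm_le_opNorm {v : ℕ → X} (hv : ∀ j, ‖v j‖ ≤ 1) (I : Finset ℕ) (S : X →L[𝕜] Y) :
    averageNorm v I S ≤ ‖S‖ := by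
  refine div_le_of_le_mul₀ (by positivity) (norm_nonneg _) ?_
  refine (sum_le_card_nsmul _ _ ‖S‖ fun j _ => S.unit_le_opNorm _ (hv j)).trans ?_
  rw [nsmul_eq_mul, mul_comm]

theorem averageNorm_smul (v : ℕ → X) (I : Finset ℕ) (c : 𝕜) (S : X →L[𝕜] Y) :
    averageNorm v I (c • S) = ‖c‖ * averageNorm v I S := by
  simp [averageNorm, norm_smul, ← mul_sum, mul_div_assoc]

/-- The operators `S` for which `‖S (B (v j))‖` is small on average over `j ∈ I m`, along the
filter `l`, for every operator `B`. -/
noncomputable def averageNullIdeal (𝕜 : Type*) {X : Type*} (Y : Type*) [NontriviallyNormedField 𝕜]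
    [NormedAddCommGroup X] [NormedSpace 𝕜 X] [NormedAddCommGroup Y] [NormedSpace 𝕜 Y]
    (v : ℕ → X) (I : ℕ → Finset ℕ) (l : Filter ℕ) : Submodule 𝕜 (X →L[𝕜] Y) where
  carrier := {S | ∀ B : X →L[𝕜] X, Tendsto (fun m => averageNorm v (I m) (S.comp B)) l (𝓝 0)}
  zero_mem' B := by simpa [averageNorm] using tendsto_const_nhds
  add_mem' {S T} hS hT B := by
    have h := (hS B).add (hT B)
    rw [add_zero] at h
    exact squeeze_zero (fun _ => averageNorm_nonneg _ _ _)
      (fun m => averageNorm_add_le v (I m) (S.comp B) (T.comp B)) h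
  smul_mem' c S hS B := by
    simpa [ContinuousLinearMap.smul_comp, averageNorm_smul] using (hS B).const_mul ‖c‖

/-- Right multiplication is absorbed by the quantifier over all B in the definition; left
multiplication costs a factor ‖A‖. -/
theorem isOperatorIdeal_averageNullIdeal (v : ℕ → X) (I : ℕ → Finset ℕ) (l : Filter ℕ) :
    IsOperatorIdeal (averageNullIdeal 𝕜 Y v I l) := by
  intro A T B hT C
  have h := (hT (B.comp C)).const_mul ‖A‖
  rw [mul_zero] at h
  exact squeeze_zero (fun _ => averageNorm_nonneg _ _ _)
    (fun m => averageNorm_comp_le v (I m) A (T.comp (B.comp C))) h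

theorem isClosed_averageNullIdeal {v : ℕ → X} (hv : ∀ j, ‖v j‖ ≤ 1) (I : ℕ → Finset ℕ)
    (l : Filter ℕ) : IsClosed (averageNullIdeal 𝕜 Y v I l : Set (X →L[𝕜] Y)) := by
  refine isClosed_of_closure_subset fun S hS B => ?_
  refine tendsto_order.2 ⟨fun a ha => Eventually.of_forall fun m =>
    ha.trans_le (averageNorm_nonneg _ _ _), fun ε hε => ?_⟩
  obtain ⟨T, hT, hST⟩ := Metric.mem_closure_iff.1 hS (ε / 2 / (‖B‖ + 1)) (by positivity)
  filter_upwards [(tendsto_order.1 (hT B)).2 (ε / 2) (by positivity)] with m hm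
  have h1 : S.comp B = T.comp B + (S - T).comp B := by ext; simp
  have h2 : averageNorm v (I m) ((S - T).comp B) ≤ ε / 2 := by
    refine (averageNorm_le_opNorm hv _ _).trans (((S - T).opNorm_comp_le B).trans ?_)
    rw [dist_eq_norm, lt_div_iff₀ (by positivity)] at hST
    nlinarith [norm_nonneg (S - T)]
  rw [h1]
  linarith [averageNorm_add_le v (I m) (T.comp B) ((S - T).comp B)]

end AverageNullIdeal

/-! ### An almost disjoint family of size continuum. -/

section BranchFamily

/-- The set of codes of the finite initial segments of a binary sequence. -/
def branchCodes (x : ℕ → Bool) : Set ℕ :=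
  Set.range fun n => Encodable.encode ((List.range n).map x)

theorem infinite_branchCodes (x : ℕ → Bool) : (branchCodes x).Infinite := by
  refine Set.infinite_range_of_injective fun m n h => ?_
  simpa using congrArg List.length (Encodable.encode_injective h)

/-- A code determines the length of its segment, and segments longer than a position where x and y
differ cannot coincide. -/
theorem finite_branchCodes_inter {x y : ℕ → Bool} (hxy : x ≠ y) :
    (branchCodes x ∩ branchCodes y).Finite := by
  obtain ⟨k, hk⟩ := Function.ne_iff.1 hxy
  refine ((Set.finite_le_nat k).image
    fun n => Encodable.encode ((List.range n).map x)).subset ?_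
  rintro _ ⟨⟨n, rfl⟩, ⟨n', h⟩⟩
  refine ⟨n, ?_, rfl⟩
  have h' := Encodable.encode_injective h
  obtain rfl : n = n' := by simpa using (congrArg List.length h').symm
  by_contra hn
  change ¬n ≤ k at hn
  rw [not_le] at hn
  exact hk (List.map_inj_left.1 h' k (List.mem_range.2 hn)).symm

end BranchFamily

/-! ### The operators, the bad-index count and the ideals. -/

namespace BlockDesign

open Finset Filter Topology

variable {𝕜 : Type*} [RCLike 𝕜] {p : ℝ≥0∞} {Q : ℝ} {s : ℕ} (d : BlockDesign s)

theorem card_S_pos (i : ℕ) : 0 < #(d.S i) := d.card_S i ▸ d.q_pos _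

theorem card_inter_le {i j : ℕ} (hij : i ≠ j) : #(d.S i ∩ d.S j) ≤ s + 3 := by
  by_cases h : d.lev i = d.lev j
  · exact d.card_inter i j hij h
  · have : Disjoint (d.S i) (d.S j) :=
      (d.disjoint_K h).mono (d.S_subset i) (d.S_subset j)
    rw [disjoint_iff_inter_eq_empty.1 this]
    simp

/-- This puts the operator's values in c₀: the ℓ_p-masses on the disjoint sets `K m` are summable
and dominate the block sums, and each level has finitely many indices. -/
theorem tendsto_blockFunctional (h : p.toReal.HolderConjugate Q) (x : lp (fun _ : ℕ => 𝕜) p) :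
    Tendsto (fun i => blockFunctional Q (d.S i) x) cofinite (𝓝 0) := by
  have hsum : Summable fun m => ∑ z ∈ d.K m, ‖x z‖ ^ p.toReal := by
    refine summable_of_sum_range_le (c := ‖x‖ ^ p.toReal) (fun m => by positivity) fun n => ?_
    rw [← sum_biUnion fun a _ b _ hab => d.disjoint_K hab]
    exact lp.sum_rpow_le_norm_rpow h.pos x _
  rw [tendsto_zero_iff_norm_tendsto_zero]
  refine tendsto_order.2 ⟨fun a ha => Eventually.of_forall fun i => ha.trans_le (norm_nonneg _),
    fun δ hδ => ?_⟩
  obtain ⟨m, hm⟩ := eventually_atTop.1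
    ((tendsto_order.1 hsum.tendsto_atTop_zero).2 (δ ^ p.toReal) (by positivity))
  refine ((range m).biUnion d.I).finite_toSet.subset fun i hi => ?_
  simp only [coe_biUnion, Set.mem_iUnion, mem_coe, mem_range]
  refine ⟨d.lev i, ?_, (d.mem_I i _).2 rfl⟩
  by_contra hlt
  refine hi ?_
  change ‖blockFunctional Q (d.S i) x‖ < δ
  rw [← Real.rpow_lt_rpow_iff (norm_nonneg _) hδ.le h.pos]
  calc ‖blockFunctional Q (d.S i) x‖ ^ p.toReal ≤ ∑ z ∈ d.S i, ‖x z‖ ^ p.toReal :=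
        norm_blockFunctional_rpow_le h (d.card_S_pos i) x
    _ ≤ ∑ z ∈ d.K (d.lev i), ‖x z‖ ^ p.toReal :=
        sum_le_sum_of_subset_of_nonneg (d.S_subset i) fun _ _ _ => by positivity
    _ < δ ^ p.toReal := hm _ (not_lt.1 hlt)

variable [Fact (1 ≤ p)]

open Classical in
/-- The operator `ℓ_p → c₀` whose coordinates are the normalised block functionals of the levels
in `N`. -/
noncomputable def operator (𝕜 : Type*) [RCLike 𝕜] (h : p.toReal.HolderConjugate Q) (N : Set ℕ) :
    lp (fun _ : ℕ => 𝕜) p →L[𝕜] C₀(ℕ, 𝕜) :=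
  LinearMap.mkContinuous
    { toFun := fun x =>
        { toFun := fun i => if d.lev i ∈ N then blockFunctional Q (d.S i) x else 0
          continuous_toFun := continuous_of_discreteTopology
          zero_at_infty' := by
            rw [cocompact_eq_cofinite]
            refine squeeze_zero_norm (fun i => ?_)
              (tendsto_zero_iff_norm_tendsto_zero.1 (d.tendsto_blockFunctional h x))
            split_ifs
            · exact le_rfl
            · simp }
      map_add' := fun x y => by
        ext i
        by_cases hi : d.lev i ∈ N <;> simp [hi]
      map_smul' := fun c x => by
        ext i
        by_cases hi : d.lev i ∈ N <;> simp [hi] } 1 fun x => by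
    rw [one_mul, ← ZeroAtInftyContinuousMap.norm_toBCF_eq_norm,
      BoundedContinuousFunction.norm_le (norm_nonneg _)]
    intro i
    by_cases hi : d.lev i ∈ N
    · simpa [hi] using norm_blockFunctional_le h (d.card_S_pos i) x
    · simp [hi]

open Classical in
theorem operator_apply (h : p.toReal.HolderConjugate Q) (N : Set ℕ)
    (x : lp (fun _ : ℕ => 𝕜) p) (i : ℕ) :
    d.operator 𝕜 h N x i = if d.lev i ∈ N then blockFunctional Q (d.S i) x else 0 := rfl

theorem norm_operator_apply_le (h : p.toReal.HolderConjugate Q) (N : Set ℕ)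
    (x : lp (fun _ : ℕ => 𝕜) p) {c : ℝ} (hc : 0 ≤ c)
    (hx : ∀ i, d.lev i ∈ N → ‖blockFunctional Q (d.S i) x‖ ≤ c) :
    ‖d.operator 𝕜 h N x‖ ≤ c := by
  rw [← ZeroAtInftyContinuousMap.norm_toBCF_eq_norm, BoundedContinuousFunction.norm_le hc]
  intro i
  change ‖d.operator 𝕜 h N x i‖ ≤ c
  rw [operator_apply]
  split_ifs with hi
  · exact hx i hi
  · simpa using hc

theorem norm_blockFunctional_le_norm_operator (h : p.toReal.HolderConjugate Q) {N : Set ℕ}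
    (x : lp (fun _ : ℕ => 𝕜) p) {i : ℕ} (hi : d.lev i ∈ N) :
    ‖blockFunctional Q (d.S i) x‖ ≤ ‖d.operator 𝕜 h N x‖ := by
  have := (d.operator 𝕜 h N x).toBCF.norm_coe_le_norm i
  rw [ZeroAtInftyContinuousMap.norm_toBCF_eq_norm] at this
  change ‖d.operator 𝕜 h N x i‖ ≤ _ at this
  rwa [operator_apply, if_pos hi] at this

theorem sum_card_I (m : ℕ) : #((range m).biUnion d.I) ≤ ∑ l ∈ range m, d.q l ^ (s + 3) :=
  card_biUnion_le.trans (sum_le_sum fun l _ => (d.card_I l).le)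

/-- Few block functionals of levels above `m` are large on a given vector. -/
theorem card_functionals_le (h : p.toReal.HolderConjugate Q) (hsP : p.toReal ≤ s) (hsQ : Q ≤ s)
    (x : lp (fun _ : ℕ => 𝕜) p) {δ : ℝ} (hδ : 0 < δ) {c m : ℕ} (hc : 1 ≤ c)
    (hxc : 2 * ‖x‖ ≤ c * δ) (hcm : c ≤ m * d.q m) (R : Finset ℕ) (hlev : ∀ i ∈ R, m < d.lev i)
    (hR : ∀ i ∈ R, δ ≤ ‖blockFunctional Q (d.S i) x‖) : #R ≤ c ^ s := by
  refine card_le_pow_of_le_block_sum h hsP hsQ hc (fun z => x z) (norm_nonneg x) hδ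
    (fun U => lp.sum_rpow_le_norm_rpow h.pos x U) hxc d.S R (D := s + 3) (fun i hi => ?_)
    (fun i _ => d.card_S_pos i) (fun i _ j _ hij => d.card_inter_le hij)
    (fun i hi => by rw [← norm_blockFunctional_apply]; exact hR i hi)
  rw [d.card_S]
  calc (s + 3) * (c ^ s + 1) * c ^ s
      ≤ (s + 3) * ((m * d.q m) ^ s + 1) * (m * d.q m) ^ s := by gcongr
    _ ≤ d.q (m + 1) := d.growth m
    _ ≤ d.q (d.lev i) := d.q_strictMono.monotone (hlev i hi)

/-- A functional is large on few block vectors of a given high level. -/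
theorem card_vectors_le (h : p.toReal.HolderConjugate Q) (hsP : p.toReal ≤ s) (hsQ : Q ≤ s)
    (g : lp (fun _ : ℕ => 𝕜) p →L[𝕜] 𝕜) {b δ : ℝ} (hδ : 0 < δ) {c m : ℕ} (hc : 1 ≤ c)
    (hg : ‖g‖ ≤ b) (hgc : 2 * b ≤ c * δ) (hcm : c < m) (R : Finset ℕ) (hRm : R ⊆ d.I m)
    (hR : ∀ j ∈ R, δ ≤ ‖g (blockVector 𝕜 p (d.S j))‖) : #R ≤ c ^ s := by
  refine card_le_pow_of_le_block_sum h.symm hsQ hsP hc (fun z => g (lp.single p z (1 : 𝕜)))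
    (norm_nonneg g) hδ (fun U => sum_norm_apply_single_rpow_le h g U) (by linarith) d.S R
    (D := s + 3) (fun i hi => ?_)
    (fun i _ => d.card_S_pos i) (fun i _ j _ hij => d.card_inter_le hij)
    (fun i hi => by rw [← norm_apply_blockVector]; exact hR i hi)
  rw [d.card_S, (d.mem_I i m).1 (hRm hi)]
  obtain ⟨n, rfl⟩ : ∃ n, m = n + 1 := ⟨m - 1, by omega⟩
  have hcn : c ≤ n * d.q n := (Nat.lt_succ_iff.1 hcm).trans (Nat.le_mul_of_pos_right _ (d.q_pos n))
  calc (s + 3) * (c ^ s + 1) * c ^ s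
      ≤ (s + 3) * ((n * d.q n) ^ s + 1) * (n * d.q n) ^ s := by gcongr
    _ ≤ d.q (n + 1) := d.growth n

/-- A large value on a block vector forces a large value on one of the unit vectors. -/
theorem exists_le_norm_apply_single (h : p.toReal.HolderConjugate Q)
    (g : lp (fun _ : ℕ => 𝕜) p →L[𝕜] 𝕜) {ε : ℝ} {j m : ℕ} (hj : j ∈ d.I m)
    (hg : ε ≤ ‖g (blockVector 𝕜 p (d.S j))‖) :
    ∃ z ∈ d.K m, ε / d.q m ≤ ‖g (lp.single p z (1 : 𝕜))‖ := by
  have hlev := (d.mem_I j m).1 hj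
  have hcard : #(d.S j) = d.q m := hlev ▸ d.card_S j
  have hq : (1 : ℝ) ≤ d.q m := by exact_mod_cast d.q_pos m
  rw [norm_apply_blockVector, hcard] at hg
  have h1 : (d.q m : ℝ) ^ (-(p.toReal)⁻¹) ≤ 1 :=
    Real.rpow_le_one_of_one_le_of_nonpos hq (by have := h.pos; simp [this.le])
  have h2 : ∑ z ∈ d.S j, ε / d.q m ≤ ∑ z ∈ d.S j, ‖g (lp.single p z (1 : 𝕜))‖ := by
    rw [sum_const, hcard, nsmul_eq_mul, mul_div_cancel₀ _ (by positivity)]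
    exact hg.trans ((mul_le_of_le_one_left (norm_nonneg _) h1).trans (norm_sum_le _ _))
  obtain ⟨z, hz, hz'⟩ := exists_le_of_sum_le (card_pos.1 (d.card_S_pos j)) h2
  exact ⟨z, hlev ▸ d.S_subset j hz, hz'⟩

-- Choose for each bad j a witness i = `π j`. Each fibre of `π` has at most c^s elements; the two
-- summands bound the witnesses from levels below and above m, level m itself being excluded by m ∉
-- N.
open Classical in
theorem card_bad_le (h : p.toReal.HolderConjugate Q) (hsP : p.toReal ≤ s) (hsQ : Q ≤ s)
    (B : lp (fun _ : ℕ => 𝕜) p →L[𝕜] lp (fun _ : ℕ => 𝕜) p) {N : Set ℕ} {ε : ℝ} (hε : 0 < ε)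
    {c m : ℕ} (hc : 1 ≤ c) (hBc : 2 * ‖B‖ ≤ c * ε) (hcm : c < m) (hmN : m ∉ N) :
    #{j ∈ d.I m | ∃ i, d.lev i ∈ N ∧
        ε ≤ ‖blockFunctional Q (d.S i) (B (blockVector 𝕜 p (d.S j)))‖}
      ≤ c ^ s * (∑ l ∈ range m, d.q l ^ (s + 3) + d.q m ^ 2 * (c * d.q m) ^ s) := by
  set bad := {j ∈ d.I m |
    ∃ i, d.lev i ∈ N ∧ ε ≤ ‖blockFunctional Q (d.S i) (B (blockVector 𝕜 p (d.S j)))‖} with hbad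
  have hq0 : (0 : ℝ) < d.q m := by exact_mod_cast d.q_pos m
  let φ : ℕ → (lp (fun _ : ℕ => 𝕜) p →L[𝕜] 𝕜) := fun i =>
    (blockFunctional Q (d.S i)).mkContinuous 1 fun x => by
      rw [one_mul]; exact norm_blockFunctional_le h (d.card_S_pos i) x
  have hφ : ∀ i, ‖(φ i).comp B‖ ≤ ‖B‖ := fun i =>
    ((φ i).opNorm_comp_le B).trans (mul_le_of_le_one_left (norm_nonneg _)
      (LinearMap.mkContinuous_norm_le _ zero_le_one _))
  have hex : ∀ j, ∃ i, j ∈ bad → d.lev i ∈ N ∧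
      ε ≤ ‖(φ i).comp B (blockVector 𝕜 p (d.S j))‖ := by
    intro j
    by_cases hj : j ∈ bad
    · obtain ⟨i, hi⟩ := (mem_filter.1 hj).2
      exact ⟨i, fun _ => hi⟩
    · exact ⟨0, fun h => absurd h hj⟩
  choose π hπ using hex
  have hbadI : bad ⊆ d.I m := filter_subset _ _
  refine (card_le_mul_card_image (f := π) bad (c ^ s) fun i _ => ?_).trans
    (Nat.mul_le_mul_left _ ?_)
  · refine d.card_vectors_le h hsP hsQ ((φ i).comp B) hε hc (hφ i) hBc hcm _
      ((filter_subset _ _).trans hbadI) fun j hj => ?_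
    obtain ⟨hjb, rfl⟩ := mem_filter.1 hj
    exact (hπ j hjb).2
  · have hsub : bad.image π ⊆ (range m).biUnion d.I ∪ (d.K m).biUnion fun z =>
        {i ∈ bad.image π | m < d.lev i ∧
          ε / d.q m ≤ ‖blockFunctional Q (d.S i) (B (lp.single p z (1 : 𝕜)))‖} := by
      intro i hi
      obtain ⟨j, hj, rfl⟩ := mem_image.1 hi
      obtain ⟨h1, h2⟩ := hπ j hj
      rcases lt_trichotomy (d.lev (π j)) m with hlt | heq | hgt
      · exact mem_union_left _ (mem_biUnion.2 ⟨_, mem_range.2 hlt, (d.mem_I _ _).2 rfl⟩)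
      · exact absurd (heq ▸ h1) hmN
      · obtain ⟨z, hz, hz'⟩ := d.exists_le_norm_apply_single h _ (hbadI hj) h2
        exact mem_union_right _ (mem_biUnion.2 ⟨z, hz, mem_filter.2 ⟨hi, hgt, hz'⟩⟩)
    refine (card_le_card hsub).trans ((card_union_le _ _).trans
      (add_le_add (d.sum_card_I m) ?_))
    rw [← d.card_K m]
    refine card_biUnion_le_card_mul _ _ _ fun z _ => ?_
    -- Lowering the threshold to ε / q m turns the constant c into c * q m, which `growth` permits
    -- because c < m.
    refine d.card_functionals_le h hsP hsQ (B (lp.single p z (1 : 𝕜))) (δ := ε / d.q m)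
      (by positivity) (m := m) (Nat.mul_pos hc (d.q_pos m)) ?_ (by gcongr) _
      (fun i hi => (mem_filter.1 hi).2.1) fun i hi => (mem_filter.1 hi).2.2
    have h1 : ‖lp.single (E := fun _ : ℕ => 𝕜) p z (1 : 𝕜)‖ = 1 := by
      rw [lp.norm_single (zero_lt_one.trans_le Fact.out), norm_one]
    have h2 := B.le_opNorm (lp.single p z (1 : 𝕜))
    rw [h1, mul_one] at h2
    push_cast
    rw [show (c : ℝ) * d.q m * (ε / d.q m) = c * ε by field_simp]
    linarith

theorem tendsto_averageNorm (h : p.toReal.HolderConjugate Q) (hsP : p.toReal ≤ s) (hsQ : Q ≤ s)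
    (B : lp (fun _ : ℕ => 𝕜) p →L[𝕜] lp (fun _ : ℕ => 𝕜) p) {N M : Set ℕ}
    (hNM : (M ∩ N).Finite) :
    Tendsto (fun m => averageNorm (fun j => blockVector 𝕜 p (d.S j)) (d.I m)
      ((d.operator 𝕜 h N).comp B)) (atTop ⊓ 𝓟 M) (𝓝 0) := by
  classical
  refine tendsto_order.2 ⟨fun a ha => Eventually.of_forall fun m =>
    ha.trans_le (averageNorm_nonneg _ _ _), fun η hη => ?_⟩
  obtain ⟨ε, hε, hεη⟩ : ∃ ε : ℝ, 0 < ε ∧ ε < η := exists_between hη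
  obtain ⟨c, hc⟩ := exists_nat_ge (max 1 (2 * ‖B‖ / ε))
  have hc1 : 1 ≤ c := by exact_mod_cast (le_max_left _ _).trans hc
  have hBc : 2 * ‖B‖ ≤ c * ε := by
    rw [← div_le_iff₀ hε]; exact (le_max_right _ _).trans hc
  -- The bad fraction of level m is at most c^s (1 + c^s) / m, and each bad vector contributes at
  -- most an extra ‖B‖.
  set L : ℝ := ‖B‖ * (c ^ s * (1 + c ^ s)) with hL
  have hsmall : ∀ᶠ m : ℕ in atTop, L / m < η - ε :=
    (tendsto_order.1 (tendsto_const_div_atTop_nhds_zero_nat L)).2 _ (by linarith)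
  obtain ⟨n, hn⟩ := hNM.bddAbove
  rw [eventually_inf_principal]
  filter_upwards [hsmall, eventually_gt_atTop c, eventually_gt_atTop n] with m hm hcm hnm hmM
  have hmN : m ∉ N := fun hmN => absurd (hn ⟨hmM, hmN⟩) (not_le.2 hnm)
  refine lt_of_le_of_lt ?_ (by linarith : ε + L / m < η)
  have hbad := d.card_bad_le h hsP hsQ B hε hc1 hBc hcm hmN
  set bad := {j ∈ d.I m |
    ∃ i, d.lev i ∈ N ∧ ε ≤ ‖blockFunctional Q (d.S i) (B (blockVector 𝕜 p (d.S j)))‖}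
  have hm0 : 0 < m := by omega
  have hcard : (0 : ℝ) < #(d.I m) := by
    rw [d.card_I]; exact_mod_cast pow_pos (d.q_pos m) _
  have hbadm : m * #bad ≤ c ^ s * (1 + c ^ s) * #(d.I m) := by
    have h1 : m * ∑ l ∈ range m, d.q l ^ (s + 3) ≤ d.q m ^ (s + 3) :=
      (d.mul_sum_le m).trans (Nat.le_self_pow (by omega) _)
    -- The exponent s + 3 is chosen for this: one power of q m beyond s + 2 remains to absorb m ≤ q
    -- m.
    have h2 : m * (d.q m ^ 2 * (c * d.q m) ^ s) ≤ c ^ s * d.q m ^ (s + 3) := by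
      have := d.q_strictMono.le_apply (x := m)
      calc m * (d.q m ^ 2 * (c * d.q m) ^ s) ≤ d.q m * (d.q m ^ 2 * (c * d.q m) ^ s) := by gcongr
        _ = _ := by ring
    calc m * #bad ≤ m * _ := Nat.mul_le_mul_left _ hbad
      _ = c ^ s * (m * ∑ l ∈ range m, d.q l ^ (s + 3) + m * (d.q m ^ 2 * (c * d.q m) ^ s)) := by
        ring
      _ ≤ c ^ s * (d.q m ^ (s + 3) + c ^ s * d.q m ^ (s + 3)) := by gcongr
      _ = _ := by rw [d.card_I]; ring
  have hterm : ∀ j ∈ d.I m, ‖((d.operator 𝕜 h N).comp B) (blockVector 𝕜 p (d.S j))‖ ≤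
      ε + if j ∈ bad then ‖B‖ else 0 := by
    intro j hj
    refine d.norm_operator_apply_le h N _ (by split_ifs <;> positivity) fun i hi => ?_
    split_ifs with hjb
    · refine (norm_blockFunctional_le h (d.card_S_pos i) _).trans ?_
      have := B.unit_le_opNorm _ (norm_blockVector_le (𝕜 := 𝕜) h.pos (d.card_S_pos j))
      exact this.trans (le_add_of_nonneg_left hε.le)
    · rw [add_zero]
      by_contra! hlt
      exact hjb (mem_filter.2 ⟨hj, i, hi, hlt.le⟩)
  rw [averageNorm, div_le_iff₀ hcard]
  refine (sum_le_sum hterm).trans ?_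
  rw [sum_add_distrib, sum_const, sum_ite_mem, inter_eq_right.2 (filter_subset _ _), sum_const,
    nsmul_eq_mul, nsmul_eq_mul, add_mul, mul_comm ε]
  refine add_le_add_right ?_ _
  have hbadm' : (m : ℝ) * #bad ≤ c ^ s * (1 + c ^ s) * #(d.I m) := by exact_mod_cast hbadm
  have hm0' : (0 : ℝ) < m := by exact_mod_cast hm0
  rw [div_mul_eq_mul_div, le_div_iff₀ hm0', hL]
  calc #bad * ‖B‖ * m = ‖B‖ * (m * #bad) := by ring
    _ ≤ ‖B‖ * (c ^ s * (1 + c ^ s) * #(d.I m)) := by gcongr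
    _ = _ := by ring

/-- The closed ideal of `L(ℓ_p, c₀)` attached to a set `M` of levels. -/
noncomputable def ideal (𝕜 : Type*) [RCLike 𝕜] (p : ℝ≥0∞) [Fact (1 ≤ p)] (M : Set ℕ) :
    Submodule 𝕜 (lp (fun _ : ℕ => 𝕜) p →L[𝕜] C₀(ℕ, 𝕜)) :=
  averageNullIdeal 𝕜 C₀(ℕ, 𝕜) (fun j => blockVector 𝕜 p (d.S j)) d.I (atTop ⊓ 𝓟 M)

theorem ideal_mem_closedOperatorIdeals (hp : 0 < p.toReal) (M : Set ℕ) :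
    d.ideal 𝕜 p M ∈ closedOperatorIdeals 𝕜 (lp (fun _ : ℕ => 𝕜) p) C₀(ℕ, 𝕜) :=
  ⟨isOperatorIdeal_averageNullIdeal _ _ _,
    isClosed_averageNullIdeal (fun j => norm_blockVector_le hp (d.card_S_pos j)) _ _⟩

theorem operator_mem_ideal (h : p.toReal.HolderConjugate Q) (hsP : p.toReal ≤ s) (hsQ : Q ≤ s)
    {N M : Set ℕ} (hNM : (M ∩ N).Finite) : d.operator 𝕜 h N ∈ d.ideal 𝕜 p M :=
  fun B => d.tendsto_averageNorm h hsP hsQ B hNM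

/-- With B the identity, coordinate j of the operator is 1 on the j-th block vector, so the averages
over levels in M are at least 1. Infinitude of M makes the filter nontrivial. -/
theorem operator_notMem_ideal (h : p.toReal.HolderConjugate Q) {M : Set ℕ} (hM : M.Infinite) :
    d.operator 𝕜 h M ∉ d.ideal 𝕜 p M := by
  intro hmem
  have hlim := (tendsto_order.1 (hmem (ContinuousLinearMap.id 𝕜 _))).2 1 zero_lt_one
  rw [eventually_inf_principal, eventually_atTop] at hlim
  obtain ⟨n, hn⟩ := hlim
  obtain ⟨m, hmM, hnm⟩ := hM.exists_gt n
  refine absurd (hn m hnm.le hmM) (not_lt.2 ?_)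
  have hcard : (0 : ℝ) < #(d.I m) := by
    rw [d.card_I]; exact_mod_cast pow_pos (d.q_pos m) _
  rw [averageNorm, le_div_iff₀ hcard, one_mul]
  refine le_of_eq_of_le (by simp) (card_nsmul_le_sum (d.I m) _ (1 : ℝ) fun j hj => ?_)
  have hlev : d.lev j ∈ M := (d.mem_I j m).1 hj ▸ hmM
  have := d.norm_blockFunctional_le_norm_operator h (blockVector 𝕜 p (d.S j)) hlev
  rwa [blockFunctional_blockVector h (d.card_S_pos j), norm_one] at this

end BlockDesign

/-- For `1 < p < ∞` there are continuum many closed ideals in `L(ℓ_p, c₀)`, over the real or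
the complex scalars. Here `lp (fun _ : ℕ => 𝕜) p` is `ℓ_p` and `C₀(ℕ, 𝕜)` (with `ℕ` discrete) is
the space `c₀` of null sequences with the supremum norm. -/
theorem theoremA {𝕜 : Type*} [RCLike 𝕜] (p : ℝ≥0∞) [Fact (1 ≤ p)] (hp : 1 < p) (hp' : p < ∞) :
    Cardinal.continuum ≤
      Cardinal.mk (closedOperatorIdeals 𝕜 (lp (fun _ : ℕ => 𝕜) p) C₀(ℕ, 𝕜)) := by
  have hP : 1 < p.toReal := by
    rwa [← ENNReal.toReal_one, ENNReal.toReal_lt_toReal ENNReal.one_ne_top hp'.ne]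
  have h : p.toReal.HolderConjugate p.toReal.conjExponent := Real.HolderConjugate.conjExponent hP
  obtain ⟨s, hs⟩ := exists_nat_ge (max p.toReal p.toReal.conjExponent)
  obtain ⟨d⟩ := nonempty_blockDesign s
  let f : (ℕ → Bool) → closedOperatorIdeals 𝕜 (lp (fun _ : ℕ => 𝕜) p) C₀(ℕ, 𝕜) := fun x =>
    ⟨d.ideal 𝕜 p (branchCodes x), d.ideal_mem_closedOperatorIdeals h.pos _⟩
  have hf : Function.Injective f := by
    intro x y hxy
    by_contra hne
    -- The operator of y's branch lies in the ideal of x's branch but not in its own.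
    have h1 := d.operator_mem_ideal (𝕜 := 𝕜) h ((le_max_left _ _).trans hs)
      ((le_max_right _ _).trans hs) (finite_branchCodes_inter hne)
    rw [show d.ideal 𝕜 p (branchCodes x) = d.ideal 𝕜 p (branchCodes y) from
      congrArg Subtype.val hxy] at h1
    exact d.operator_notMem_ideal h (infinite_branchCodes y) h1
  have := Cardinal.lift_mk_le_lift_mk_of_injective hf
  simpa using this
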